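/- Conventions. Let $(M,g)$ be a smooth time-oriented Lorentzian manifold of dimension $n+1$ and signature $(-,+,\dots,+)$. For a spacelike hypersurface with future-directed unit normal $\nu$ put $K_{ij}=g(\nabla_{\partial_i}\nu,\partial_j)$ and let $K=h^{ij}K_{ij}$ be its mean curvature, where $h$ is the induced metric (so $K>0$ means expansion). A Cauchy surface of an open set $U\subseteq M$ is a subset of $U$ met exactly once by every timelike curve in $U$ that is inextendible in $U$; $U$ is globally hyperbolic if it has one. A *future crushing function* with constant $c_0\ge 0$ is a continuous function $\tilde t:M\to\mathbb R$ for which there is an open set $\mathcal N\subseteq M$, containing the level sets $S_c=\{\tilde t=c\}$ for all $c>c_0$, such that $U=\mathcal N\cap\{\tilde t>c_0\}$ is globally hyperbolic, $\tilde t$ is on $U$ a smooth Cauchy time function with range $(c_0,\infty)$ (that is, $\tilde t(U)=(c_0,\infty)$, $d\tilde t(v)>0$ for all future-directed causal $v$, and each $S_c$, $c>c_0$, is a Cauchy surface of $U$), and $S_c$ has mean curvature $<-c$ at each of its points, for every $c>c_0$. A *mean curvature flow* on an interval $J\subseteq[0,\infty)$ containing $0$ (for instance $J=[0,\lambda_0)$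 with $0<\lambda_0\le\infty$) is a smooth map $y:J\times Q\to M$, with $Q$ a compact $n$-manifold, such that each $y(\lambda,\cdot)$ is a spacelike immersion, with image $M_\lambda$, and $\partial_\lambda y=K\nu$, where $\nu$ and $K$ are the future-directed unit normal and the mean curvature of $y(\lambda,\cdot)$. Theorem. Let $\tilde t$ be a future crushing function on $M$ with constant $c_0$, and let $(M_\lambda)_{\lambda\in J}$ be a mean curvature flow in $M$ whose initial surface $M_0$ has $K\ge 0$. Then $M_\lambda$ stays away from the crushing singularity: there is $c>c_0$ such that $M_\lambda\subseteq\{\tilde t<c\}$ for all $\lambda\in J$. More precisely, for every $c>c_0$ with $M_0\subseteq\{\tilde t<c\}$, one has $M_\lambda\subseteq\{\tilde t<c\}$ for all $\lambda\in J$. -/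

import Mathlib

open Set Filter Topology
open scoped Manifold ContDiff

noncomputable section

namespace NoCrushing

/-- A spacetime of dimension `n + 1`: a smooth Lorentzian metric `g` of signature `(-, +, …, +)`
on the smooth manifold `M`, together with a time orientation, given by a continuous timelike
vector field `T`. -/
structure Spacetime (n : ℕ) (M : Type*) [TopologicalSpace M]
    [ChartedSpace (EuclideanSpace ℝ (Fin (n + 1))) M] [IsManifold (𝓡 (n + 1)) ∞ M] where
  /-- the metric tensor -/
  g : ∀ p : M, TangentSpace (𝓡 (n + 1)) p →L[ℝ] TangentSpace (𝓡 (n + 1)) p →L[ℝ] ℝ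
  symm : ∀ (p : M) (v w : TangentSpace (𝓡 (n + 1)) p), g p v w = g p w v
  lorentzian : ∀ p : M, ∃ u : TangentSpace (𝓡 (n + 1)) p, g p u u < 0 ∧
    ∀ v : TangentSpace (𝓡 (n + 1)) p, g p u v = 0 → v ≠ 0 → 0 < g p v v
  smooth : ContMDiff (𝓡 (n + 1))
    ((𝓡 (n + 1)).prod 𝓘(ℝ, EuclideanSpace ℝ (Fin (n + 1)) →L[ℝ]
      EuclideanSpace ℝ (Fin (n + 1)) →L[ℝ] ℝ)) ∞
    (fun p ↦ Bundle.TotalSpace.mk' (EuclideanSpace ℝ (Fin (n + 1)) →L[ℝ]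
      EuclideanSpace ℝ (Fin (n + 1)) →L[ℝ] ℝ) p (g p))
  /-- the time orientation -/
  T : ∀ p : M, TangentSpace (𝓡 (n + 1)) p
  T_continuous : Continuous (fun p ↦ (⟨p, T p⟩ : TangentBundle (𝓡 (n + 1)) M))
  T_timelike : ∀ p : M, g p (T p) (T p) < 0

variable {n : ℕ} {M : Type*} [TopologicalSpace M]
  [ChartedSpace (EuclideanSpace ℝ (Fin (n + 1))) M] [IsManifold (𝓡 (n + 1)) ∞ M]

namespace Spacetime

/-- `v` is a future-directed causal vector (timelike or null, and non-zero). -/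
def FutureCausal (S : Spacetime n M) {p : M} (v : TangentSpace (𝓡 (n + 1)) p) : Prop :=
  S.g p v v ≤ 0 ∧ S.g p (S.T p) v < 0

/-- `v` is a future-directed timelike vector. -/
def FutureTimelike (S : Spacetime n M) {p : M} (v : TangentSpace (𝓡 (n + 1)) p) : Prop :=
  S.g p v v < 0 ∧ S.g p (S.T p) v < 0

/-! ### Causality: Cauchy surfaces and Cauchy time functions of an open region -/

/-- `γ` is a future-directed timelike curve of the region `U` without past and future endpoints
in `U`. (The parameter interval of such a curve is open, and can be taken to be `ℝ`.) -/
structure IsInextendibleTimelikeCurve (S : Spacetime n M) (U : Set M) (γ : ℝ → M) : Prop where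
  contMDiff : ContMDiff 𝓘(ℝ, ℝ) (𝓡 (n + 1)) 1 γ
  mem : ∀ s, γ s ∈ U
  timelike : ∀ s, S.FutureTimelike
    (mfderiv 𝓘(ℝ, ℝ) (𝓡 (n + 1)) γ s (1 : ℝ) : TangentSpace (𝓡 (n + 1)) (γ s))
  no_future_endpoint : ¬ ∃ p ∈ U, Tendsto γ atTop (𝓝 p)
  no_past_endpoint : ¬ ∃ p ∈ U, Tendsto γ atBot (𝓝 p)

/-- `A` is a Cauchy surface of the region `U`: every inextendible timelike curve of `U` meets it
exactly once. -/
def IsCauchySurface (S : Spacetime n M) (U A : Set M) : Prop :=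
  A ⊆ U ∧ ∀ γ : ℝ → M, S.IsInextendibleTimelikeCurve U γ → ∃! s : ℝ, γ s ∈ A

/-- The open region `U`, as a spacetime, is globally hyperbolic: it has a Cauchy surface. -/
def IsGloballyHyperbolic (S : Spacetime n M) (U : Set M) : Prop :=
  IsOpen U ∧ ∃ A : Set M, S.IsCauchySurface U A

/-- `τ` is a (smooth) Cauchy time function with range `(c₀, ∞)` on the open region `U`: it is
strictly increasing to the future, `dτ` being positive on future-directed causal vectors (that is,
its gradient is past-directed timelike), and all its level sets in `U` are Cauchy surfaces of
`U`. -/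
structure IsCauchyTimeFunctionOn (S : Spacetime n M) (U : Set M) (τ : M → ℝ) (c₀ : ℝ) : Prop where
  smooth : ContMDiffOn (𝓡 (n + 1)) 𝓘(ℝ, ℝ) ∞ τ U
  increasing : ∀ p ∈ U, ∀ v : TangentSpace (𝓡 (n + 1)) p, S.FutureCausal v →
    (0 : ℝ) < mfderiv (𝓡 (n + 1)) 𝓘(ℝ, ℝ) τ p v
  range : τ '' U = Ioi c₀
  cauchy : ∀ c, c₀ < c → S.IsCauchySurface U {p ∈ U | τ p = c}

/-! ### The Levi-Civita connection in coordinates, and mean curvature -/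

/-- The component function `q ↦ g_q(∂_v, ∂_w)` of the metric in the preferred chart around `p`;
here `∂_v` is the coordinate vector field of that chart with constant components `v`. -/
def metricCoeff (S : Spacetime n M) (p : M) (v w : EuclideanSpace ℝ (Fin (n + 1))) (q : M) : ℝ :=
  S.g q ((trivializationAt (EuclideanSpace ℝ (Fin (n + 1))) (TangentSpace (𝓡 (n + 1))) p).symm q v)
    ((trivializationAt (EuclideanSpace ℝ (Fin (n + 1))) (TangentSpace (𝓡 (n + 1))) p).symm q w)

/-- The derivative at `p` of the metric component `g(∂_v, ∂_w)` in the direction `u`. -/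
def dMetricCoeff (S : Spacetime n M) (p : M) (u v w : EuclideanSpace ℝ (Fin (n + 1))) : ℝ :=
  mfderiv (𝓡 (n + 1)) 𝓘(ℝ, ℝ) (S.metricCoeff p v w) p u

/-- The Christoffel symbols of the first kind at `p`, in the preferred chart around `p`:
`g(∇_{∂_u} ∂_v, ∂_w) = (∂_u g(∂_v, ∂_w) + ∂_v g(∂_u, ∂_w) - ∂_w g(∂_u, ∂_v)) / 2`. -/
def christoffel (S : Spacetime n M) (p : M) (u v w : EuclideanSpace ℝ (Fin (n + 1))) : ℝ :=
  (S.dMetricCoeff p u v w + S.dMetricCoeff p v u w - S.dMetricCoeff p w u v) / 2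

section Along

variable {m : ℕ} {Q : Type*} [TopologicalSpace Q] [ChartedSpace (EuclideanSpace ℝ (Fin m)) Q]

/-- The components, in the preferred chart of `M` around `f x`, of the vector field `X` along the
map `f`. -/
def components (f : Q → M) (X : ∀ x, TangentSpace (𝓡 (n + 1)) (f x)) (x x' : Q) :
    EuclideanSpace ℝ (Fin (n + 1)) :=
  (trivializationAt (EuclideanSpace ℝ (Fin (n + 1))) (TangentSpace (𝓡 (n + 1))) (f x)
    (⟨f x', X x'⟩ : TangentBundle (𝓡 (n + 1)) M)).2

/-- `g(∇_ξ X, w)` for a vector field `X` along the map `f`, where `∇` is the Levi-Civita connection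
of `M`, `ξ` a tangent vector of the source of `f` at `x`, and `w` a tangent vector of `M` at
`f x`. (Tangent vectors of `M` at `f x` are represented by their components in the preferred chart
around `f x`.) -/
def covDeriv (S : Spacetime n M) (f : Q → M) (X : ∀ x, TangentSpace (𝓡 (n + 1)) (f x)) (x : Q)
    (ξ : TangentSpace (𝓡 m) x) (w : TangentSpace (𝓡 (n + 1)) (f x)) : ℝ :=
  S.g (f x) (mfderiv (𝓡 m) 𝓘(ℝ, EuclideanSpace ℝ (Fin (n + 1))) (components f X x) x ξ) w
    + S.christoffel (f x) (mfderiv (𝓡 m) (𝓡 (n + 1)) f x ξ) (X x) w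

/-- The `i`-th coordinate vector at `x`, pushed forward by `f`. -/
def frame (f : Q → M) (x : Q) (i : Fin m) : TangentSpace (𝓡 (n + 1)) (f x) :=
  mfderiv (𝓡 m) (𝓡 (n + 1)) f x (EuclideanSpace.single i (1 : ℝ) : EuclideanSpace ℝ (Fin m))

/-- The matrix `h_{ij}` of the metric induced by `f`. -/
def inducedMetric (S : Spacetime n M) (f : Q → M) (x : Q) : Matrix (Fin m) (Fin m) ℝ :=
  Matrix.of fun i j ↦ S.g (f x) (frame (m := m) f x i) (frame (m := m) f x j)

/-- The divergence along `f` of a vector field `X` along `f`: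
`∑ i j, h^{ij} g(∇_{∂_i} X, ∂_j f)`. -/
def divAlong (S : Spacetime n M) (f : Q → M) (X : ∀ x, TangentSpace (𝓡 (n + 1)) (f x))
    (x : Q) : ℝ :=
  ∑ i, ∑ j, (S.inducedMetric f x)⁻¹ i j *
    S.covDeriv f X x (EuclideanSpace.single i (1 : ℝ) : EuclideanSpace ℝ (Fin m)) (frame f x j)

/-- `f` is a spacelike immersion: the induced metric is positive definite. -/
def IsSpacelike (S : Spacetime n M) (f : Q → M) : Prop :=
  ∀ (x : Q) (ξ : TangentSpace (𝓡 m) x), ξ ≠ 0 →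
    0 < S.g (f x) (mfderiv (𝓡 m) (𝓡 (n + 1)) f x ξ) (mfderiv (𝓡 m) (𝓡 (n + 1)) f x ξ)

/-- `ν` is the future-directed unit normal field of the hypersurface `f`. -/
structure IsFutureUnitNormal (S : Spacetime n M) (f : Q → M)
    (ν : ∀ x, TangentSpace (𝓡 (n + 1)) (f x)) : Prop where
  smooth : ContMDiff (𝓡 m) (𝓡 (n + 1)).tangent ∞
    (fun x ↦ (⟨f x, ν x⟩ : TangentBundle (𝓡 (n + 1)) M))
  unit : ∀ x, S.g (f x) (ν x) (ν x) = -1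
  future : ∀ x, S.FutureTimelike (ν x)
  normal : ∀ (x : Q) (ξ : TangentSpace (𝓡 m) x),
    S.g (f x) (ν x) (mfderiv (𝓡 m) (𝓡 (n + 1)) f x ξ) = 0

end Along

/-- The mean curvature `K = h^{ij} K_{ij}`, `K_{ij} = g(∇_{∂_i} ν, ∂_j f)`, of the hypersurface `f`
with unit normal `ν`; with `ν` future-directed, `K > 0` means expansion. -/
def meanCurvature (S : Spacetime n M) {Q : Type*} [TopologicalSpace Q]
    [ChartedSpace (EuclideanSpace ℝ (Fin n)) Q] (f : Q → M)
    (ν : ∀ x, TangentSpace (𝓡 (n + 1)) (f x)) (x : Q) : ℝ :=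
  S.divAlong (m := n) f ν x

/-- `ν` is, on the open region `U`, the future-directed unit normal field of the level sets
of `τ`. -/
structure IsLevelSetNormalOn (S : Spacetime n M) (U : Set M) (τ : M → ℝ)
    (ν : ∀ p : M, TangentSpace (𝓡 (n + 1)) p) : Prop where
  smooth : ContMDiffOn (𝓡 (n + 1)) (𝓡 (n + 1)).tangent ∞
    (fun p ↦ (⟨p, ν p⟩ : TangentBundle (𝓡 (n + 1)) M)) U
  unit : ∀ p ∈ U, S.g p (ν p) (ν p) = -1
  future : ∀ p ∈ U, S.FutureTimelike (ν p)
  normal : ∀ p ∈ U, ∀ v : TangentSpace (𝓡 (n + 1)) p,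
    mfderiv (𝓡 (n + 1)) 𝓘(ℝ, ℝ) τ p v = (0 : ℝ) → S.g p (ν p) v = 0

/-- The mean curvature `K = g^{μν} ∇_μ ν_ν` at `p` of the level set through `p` of a time function
with unit normal field `ν`. (As `ν` is a unit field, the trace over the whole tangent space agrees
with the trace over the tangent space of the level set.) -/
def levelSetMeanCurvature (S : Spacetime n M) (ν : ∀ p : M, TangentSpace (𝓡 (n + 1)) p)
    (p : M) : ℝ :=
  S.divAlong (m := n + 1) (fun q : M ↦ q) ν p

/-- `τ` is a future crushing function, with constant `c₀ ≥ 0` and neighbourhood `N`: a continuous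
function on the whole spacetime which on the globally hyperbolic region `N ∩ {τ > c₀}` is a Cauchy
time function with range `(c₀, ∞)`, and whose level sets `{τ = c}`, `c > c₀`, are contained in `N`
and have mean curvature `< -c`. -/
structure IsFutureCrushing (S : Spacetime n M) (N : Set M) (τ : M → ℝ) (c₀ : ℝ) : Prop where
  nonneg : 0 ≤ c₀
  continuous : Continuous τ
  isOpen : IsOpen N
  level_subset : ∀ c, c₀ < c → {p | τ p = c} ⊆ N
  globallyHyperbolic : S.IsGloballyHyperbolic (N ∩ {p | c₀ < τ p})
  cauchyTime : S.IsCauchyTimeFunctionOn (N ∩ {p | c₀ < τ p}) τ c₀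
  meanCurvature_lt : ∃ ν : ∀ p : M, TangentSpace (𝓡 (n + 1)) p,
    S.IsLevelSetNormalOn (N ∩ {p | c₀ < τ p}) τ ν ∧
      ∀ c, c₀ < c → ∀ p, τ p = c → S.levelSetMeanCurvature ν p < -c

/-- A mean curvature flow of compact spacelike hypersurfaces, for parameters in the interval `J`:
`y s : Q → M` is the hypersurface with parameter `s`, `ν s` its future-directed unit normal, and
`dy/ds = K ν`. -/
structure IsMeanCurvatureFlow (S : Spacetime n M) {Q : Type*} [TopologicalSpace Q]
    [ChartedSpace (EuclideanSpace ℝ (Fin n)) Q] (J : Set ℝ) (y : ℝ → Q → M)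
    (ν : ∀ s x, TangentSpace (𝓡 (n + 1)) (y s x)) : Prop where
  smooth : ContMDiffOn (𝓘(ℝ, ℝ).prod (𝓡 n)) (𝓡 (n + 1)) ∞
    (fun z : ℝ × Q ↦ y z.1 z.2) (J ×ˢ univ)
  spacelike : ∀ s ∈ J, S.IsSpacelike (m := n) (y s)
  normal : ∀ s ∈ J, S.IsFutureUnitNormal (m := n) (y s) (ν s)
  flow : ∀ s ∈ J, ∀ x, HasMFDerivWithinAt 𝓘(ℝ, ℝ) (𝓡 (n + 1)) (fun r ↦ y r x) J s
    ((1 : ℝ →L[ℝ] ℝ).smulRight (S.meanCurvature (y s) (ν s) x • ν s x))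

end Spacetime

end NoCrushing

end

/-! This is a maximum principle argument at a first touching time. If the flow starts in `τ < c` but
leaves this set, compactness of `Q` gives a first time `s > 0` and a point `x` with `τ (y s x) = c`,
and `τ` restricted to the surface at time `s` is maximal at `x`. There the surface touches the level
set of `τ` from the past, so the two future unit normals agree and the mean curvature of the surface
is at most that of the level set, hence `< -c < 0`. The flow then moves `x` towards the past: the
time derivative of `τ (y r x)` at `s` is `K · dτ(ν) < 0`. But `s` is a first touching time, so that
derivative is nonnegative.

The geometric core is `covDeriv_le_of_isLocalMax`, proved without second derivatives of `τ`. On `U`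
one has `dτ = -dτ(ν) g(ν, ·)`, and the normal `νf` of the surface `f` annihilates tangent vectors.
So along a curve `σ` in the surface the derivative of `τ` is `dτ(ν) g(νf - ν, σ')`. The difference
`νf - ν` vanishes at the maximum, so its first-order growth decides the sign and compares the two
second fundamental forms. Traces in adapted orthonormal frames (`divAlong_eq_sum`) then give
`meanCurvature_le_of_isLocalMax`. -/

namespace NoCrushing

open Bundle

/-! ### Curves with prescribed velocity -/

section Curves

variable {m : ℕ} {Q : Type*} [TopologicalSpace Q] [ChartedSpace (EuclideanSpace ℝ (Fin m)) Q]
  [IsManifold (𝓡 m) ∞ Q]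

/-- Every tangent vector is the velocity of a smooth curve. -/
theorem exists_curve (x : Q) (ξ : EuclideanSpace ℝ (Fin m)) :
    ∃ γ : ℝ → Q, γ 0 = x ∧ ContMDiffAt 𝓘(ℝ, ℝ) (𝓡 m) ∞ γ 0 ∧
      HasMFDerivAt 𝓘(ℝ, ℝ) (𝓡 m) γ 0 ((1 : ℝ →L[ℝ] ℝ).smulRight ξ) := by
  set e := extChartAt (𝓡 m) x with he
  have hmem : e x + (0 : ℝ) • ξ ∈ e.target := by simp [he]
  have hcont : Continuous (fun t : ℝ ↦ e x + t • ξ) := by fun_prop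
  have hsmooth : ContMDiffAt 𝓘(ℝ, ℝ) (𝓡 m) ∞ (fun t : ℝ ↦ e.symm (e x + t • ξ)) 0 := by
    have h1 : ContMDiffAt 𝓘(ℝ, EuclideanSpace ℝ (Fin m)) (𝓡 m) ∞ e.symm (e x + (0 : ℝ) • ξ) :=
      (contMDiffOn_extChartAt_symm x).contMDiffAt ((isOpen_extChartAt_target x).mem_nhds hmem)
    have h2 : ContMDiffAt 𝓘(ℝ, ℝ) 𝓘(ℝ, EuclideanSpace ℝ (Fin m)) ∞
        (fun t : ℝ ↦ e x + t • ξ) 0 := by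
      apply ContDiffAt.contMDiffAt
      fun_prop
    exact ContMDiffAt.comp (0 : ℝ) h1 h2
  have h0 : e.symm (e x + (0 : ℝ) • ξ) = x := by simp [he]
  refine ⟨fun t ↦ e.symm (e x + t • ξ), h0, hsmooth, hsmooth.continuousAt, ?_⟩
  simp only [writtenInExtChartAt, extChartAt_model_space_eq_id, PartialEquiv.refl_coe,
    PartialEquiv.refl_symm, Function.comp_id, id, modelWithCornersSelf_coe, range_id, h0]
  have hlin : HasDerivAt (fun t : ℝ ↦ e x + t • ξ) ξ (0 : ℝ) := by
    simpa using ((hasDerivAt_id (0 : ℝ)).smul_const ξ).const_add (e x)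
  refine (HasFDerivAt.congr_of_eventuallyEq (f := fun t : ℝ ↦ e x + t • ξ) (f' := (1 : ℝ →L[ℝ] ℝ).smulRight ξ) ?_
    ?_).hasFDerivWithinAt
  · exact hlin.hasFDerivAt.congr_fderiv (by ext; simp)
  -- In the chart the curve is affine only as long as it stays in the chart's target, hence for `t`
  -- near `0`.
  filter_upwards [hcont.continuousAt.preimage_mem_nhds
    ((isOpen_extChartAt_target x).mem_nhds hmem)] with t ht
  exact e.right_inv ht

end Curves

/-! ### The metric as a form-valued function in a chart -/

namespace Spacetime

variable {n : ℕ} {M : Type*} [TopologicalSpace M]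
  [ChartedSpace (EuclideanSpace ℝ (Fin (n + 1))) M] [IsManifold (𝓡 (n + 1)) ∞ M]

theorem trivializationAt_self (p : M) (v : TangentSpace (𝓡 (n + 1)) p) :
    (trivializationAt (EuclideanSpace ℝ (Fin (n + 1))) (TangentSpace (𝓡 (n + 1))) p
      (⟨p, v⟩ : TangentBundle (𝓡 (n + 1)) M)).2 = v := by
  rw [TangentBundle.trivializationAt_apply]
  exact tangentCoordChange_self (I := 𝓡 (n + 1)) (x := p) (z := p) (by simp)

/-- The metric in the preferred chart around `p`, as a function with values in the bilinear forms
on the model space. -/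
noncomputable def metricInChart (S : Spacetime n M) (p q : M) :
    EuclideanSpace ℝ (Fin (n + 1)) →L[ℝ] EuclideanSpace ℝ (Fin (n + 1)) →L[ℝ] ℝ :=
  (trivializationAt (EuclideanSpace ℝ (Fin (n + 1)) →L[ℝ]
      EuclideanSpace ℝ (Fin (n + 1)) →L[ℝ] ℝ)
    (fun q : M ↦ TangentSpace (𝓡 (n + 1)) q →L[ℝ] TangentSpace (𝓡 (n + 1)) q →L[ℝ] ℝ) p
    (TotalSpace.mk' _ q (S.g q))).2

theorem metricInChart_apply (S : Spacetime n M) (p q : M)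
    (hq : q ∈ (chartAt (EuclideanSpace ℝ (Fin (n + 1))) p).source)
    (v w : EuclideanSpace ℝ (Fin (n + 1))) :
    S.metricInChart p q v w = S.metricCoeff p v w q := by
  have hq' : q ∈ (trivializationAt (EuclideanSpace ℝ (Fin (n + 1)))
    (TangentSpace (𝓡 (n + 1))) p).baseSet := hq
  have hq₂ : q ∈ (chartAt (EuclideanSpace ℝ (Fin (n + 1))) p).source ∩
      (Trivial.trivialization M ℝ).baseSet := ⟨hq, mem_univ q⟩
  simp [metricInChart, metricCoeff, hom_trivializationAt_apply,
    ContinuousLinearMap.inCoordinates, Trivialization.linearMapAt_apply,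
    Trivialization.symmL_apply _ hq']
  refine (congrArg (fun L : TangentSpace (𝓡 (n + 1)) p →L[ℝ] ℝ ↦ L w) (if_pos hq₂)).trans ?_
  exact congrArg (S.g q _) (Trivialization.symmL_apply (R := ℝ) _ hq' w)

/-- Lets `g` of two moving vectors be differentiated by the product rule: form and components all
take values in fixed vector spaces. -/
theorem metricInChart_apply_components (S : Spacetime n M) (p q : M)
    (hq : q ∈ (chartAt (EuclideanSpace ℝ (Fin (n + 1))) p).source)
    (v w : TangentSpace (𝓡 (n + 1)) q) :
    S.metricInChart p q
      (trivializationAt (EuclideanSpace ℝ (Fin (n + 1))) (TangentSpace (𝓡 (n + 1))) p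
        (⟨q, v⟩ : TangentBundle (𝓡 (n + 1)) M)).2
      (trivializationAt (EuclideanSpace ℝ (Fin (n + 1))) (TangentSpace (𝓡 (n + 1))) p
        (⟨q, w⟩ : TangentBundle (𝓡 (n + 1)) M)).2 = S.g q v w := by
  have hq' : q ∈ (trivializationAt (EuclideanSpace ℝ (Fin (n + 1)))
    (TangentSpace (𝓡 (n + 1))) p).baseSet := hq
  rw [metricInChart_apply S p q hq, metricCoeff, Trivialization.symm_apply_apply_mk _ hq',
    Trivialization.symm_apply_apply_mk _ hq']

theorem metricInChart_self (S : Spacetime n M) (p : M)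
    (v w : TangentSpace (𝓡 (n + 1)) p) : S.metricInChart p p v w = S.g p v w := by
  have h := S.metricInChart_apply_components p p (mem_chart_source _ p) v w
  rwa [trivializationAt_self, trivializationAt_self] at h

theorem metricInChart_contMDiffAt (S : Spacetime n M) (p : M) :
    ContMDiffAt (𝓡 (n + 1)) 𝓘(ℝ, EuclideanSpace ℝ (Fin (n + 1)) →L[ℝ]
      EuclideanSpace ℝ (Fin (n + 1)) →L[ℝ] ℝ) ∞ (S.metricInChart p) p := by
  exact (contMDiffAt_section p).1 S.smooth.contMDiffAt

end Spacetime

/-! ### One-variable calculus and Lorentzian linear algebra -/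

section Calculus

/-- A positive derivative to the right of `0` makes `u` strictly increasing on some `[0, ε]`. The
derivative at `0` itself may vanish, as it does at a critical point. -/
theorem not_isLocalMax_of_hasDerivAt_pos {u d : ℝ → ℝ}
    (hd : ∀ᶠ t in 𝓝 (0 : ℝ), HasDerivAt u (d t) t) (hpos : ∀ᶠ t in 𝓝[>] (0 : ℝ), 0 < d t) :
    ¬ IsLocalMax u 0 := by
  intro hmax
  obtain ⟨ε₁, hε₁, h₁⟩ := Metric.eventually_nhds_iff.1 (hd.and hmax)
  obtain ⟨ε₂, hε₂, h₂⟩ := mem_nhdsGT_iff_exists_Ioo_subset.1 hpos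
  have hε₂ : (0 : ℝ) < ε₂ := hε₂
  set ε := min ε₁ ε₂ / 2 with hε
  have hεpos : 0 < ε := half_pos (lt_min hε₁ hε₂)
  have hlt₁ : ε < ε₁ := by have := min_le_left ε₁ ε₂; linarith [half_lt_self (lt_min hε₁ hε₂)]
  have hlt₂ : ε < ε₂ := by have := min_le_right ε₁ ε₂; linarith [half_lt_self (lt_min hε₁ hε₂)]
  have key : ∀ t ∈ Icc 0 ε, HasDerivAt u (d t) t := fun t ht ↦
    (h₁ (by rw [Real.dist_eq, sub_zero, abs_of_nonneg ht.1]; linarith [ht.2])).1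
  have hmono : StrictMonoOn u (Icc 0 ε) := by
    refine strictMonoOn_of_deriv_pos (convex_Icc 0 ε)
      (fun t ht ↦ (key t ht).continuousAt.continuousWithinAt) fun t ht ↦ ?_
    rw [interior_Icc] at ht
    rw [(key t (Ioo_subset_Icc_self ht)).deriv]
    exact h₂ ⟨ht.1, ht.2.trans hlt₂⟩
  have h₃ := hmono (left_mem_Icc.2 hεpos.le) (right_mem_Icc.2 hεpos.le) hεpos
  have h₄ := (h₁ (y := ε) (by rwa [Real.dist_eq, sub_zero, abs_of_pos hεpos])).2
  exact absurd h₃ (not_lt.2 h₄)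

/-- Since `m 0 = 0`, the quotient `m t / t` tends to `m'`, so `G t (m t / t) (X t)` tends to a
positive number; multiplying by `t > 0` keeps the sign. Only continuity of `G` and `X` is needed. -/
theorem eventually_bilin_pos {E : Type*} [NormedAddCommGroup E] [NormedSpace ℝ E]
    {G : ℝ → E →L[ℝ] E →L[ℝ] ℝ} {m X : ℝ → E} {m' : E} (hG : ContinuousAt G 0)
    (hX : ContinuousAt X 0) (hm : HasDerivAt m m' 0) (hm0 : m 0 = 0)
    (hpos : 0 < G 0 m' (X 0)) : ∀ᶠ t in 𝓝[>] (0 : ℝ), 0 < G t (m t) (X t) := by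
  have hslope : Tendsto (fun t : ℝ ↦ t⁻¹ • m t) (𝓝[>] 0) (𝓝 m') := by
    have h := hm.tendsto_slope_zero_right
    simpa [hm0] using h
  have hlim : Tendsto (fun t : ℝ ↦ G t (t⁻¹ • m t) (X t)) (𝓝[>] 0) (𝓝 (G 0 m' (X 0))) :=
    (isBoundedBilinearMap_apply.continuous.tendsto (G 0 m', X 0)).comp
      (((isBoundedBilinearMap_apply.continuous.tendsto (G 0, m')).comp
        ((hG.tendsto.mono_left nhdsWithin_le_nhds).prodMk_nhds hslope)).prodMk_nhds
        (hX.tendsto.mono_left nhdsWithin_le_nhds))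
  filter_upwards [hlim.eventually_const_lt hpos, self_mem_nhdsWithin] with t ht ht0
  have ht0 : 0 < t := ht0
  simp only [map_smul, smul_apply, smul_eq_mul] at ht
  exact (pos_iff_pos_of_mul_pos ht).1 (inv_pos.2 ht0)

/-- Subtracting a multiple of `N` moves `v` into `ker φ`, which is orthogonal to `N`. Applied to `φ
= dτ`, this says that the gradient of `τ` is a negative multiple of the unit normal. -/
theorem form_eq_neg_mul_bilin {V : Type*} [AddCommGroup V] [Module ℝ V] [TopologicalSpace V]
    (B : V →L[ℝ] V →L[ℝ] ℝ) (φ : V →L[ℝ] ℝ) {N : V} (hN : B N N = -1) (hφ : 0 < φ N)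
    (h : ∀ v, φ v = 0 → B N v = 0) (v : V) : φ v = φ N * -B N v := by
  have h0 : φ (v - (φ v / φ N) • N) = 0 := by
    simp only [map_sub, map_smul, smul_eq_mul]
    field_simp
    ring
  have h1 := h _ h0
  simp only [map_sub, map_smul, smul_eq_mul, hN] at h1
  field_simp at h1
  linarith

/-- Two timelike unit vectors orthogonal to the same spacelike hyperplane and in the same time cone
agree. -/
theorem unit_normal_unique {V : Type*} [AddCommGroup V] [Module ℝ V] [TopologicalSpace V]
    [FiniteDimensional ℝ V] (B : V →L[ℝ] V →L[ℝ] ℝ)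
    (W : Submodule ℝ V) (hW : Module.finrank ℝ V = Module.finrank ℝ W + 1)
    (hpos : ∀ w ∈ W, w ≠ 0 → 0 < B w w) {T N N' : V} (hN : B N N = -1) (hN' : B N' N' = -1)
    (hNW : ∀ w ∈ W, B N w = 0) (hNW' : ∀ w ∈ W, B N' w = 0) (hT : B T N < 0) (hT' : B T N' < 0) : N' = N := by
  have hNmem : N ∉ W := fun hmem ↦ by
    have := hNW N hmem
    rw [hN] at this
    norm_num at this
  have hsup : W ⊔ Submodule.span ℝ {N} = ⊤ := by
    apply Submodule.eq_top_of_finrank_eq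
    have hlt : W < W ⊔ Submodule.span ℝ {N} := by
      refine lt_of_le_of_ne le_sup_left fun heq ↦ hNmem ?_
      rw [heq]
      exact Submodule.mem_sup_right (Submodule.mem_span_singleton_self N)
    have h1 := Submodule.finrank_lt_finrank_of_lt hlt
    have h2 := Submodule.finrank_le (W ⊔ Submodule.span ℝ {N})
    omega
  have hmem : N' ∈ W ⊔ Submodule.span ℝ {N} := hsup ▸ Submodule.mem_top
  obtain ⟨w, hw, z, hz, hwz⟩ := Submodule.mem_sup.1 hmem
  obtain ⟨a, rfl⟩ := Submodule.mem_span_singleton.1 hz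
  -- With `N' = w + a N`, pairing with `w` leaves only `B w w`, which must vanish.
  have hw0 : w = 0 := by
    by_contra hne
    have h1 := hpos w hw hne
    have h2 := hNW' w hw
    rw [← hwz, map_add, map_smul, add_apply, smul_apply,
      hNW w hw, smul_zero, add_zero] at h2
    exact h1.ne' h2
  rw [hw0, zero_add] at hwz
  subst hwz
  simp only [map_smul, smul_apply, smul_eq_mul, hN] at hN' hT'
  -- The unit condition gives `a² = 1`; the common time cone excludes `a = -1`.
  have ha : 0 < a := pos_of_mul_neg_left hT' hT.le
  have ha1 : a = 1 := by nlinarith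
  rw [ha1, one_smul]

end Calculus

/-! ### Derivatives along curves, and covariant derivatives of unit normals -/

namespace Spacetime

variable {n : ℕ} {M : Type*} [TopologicalSpace M]
  [ChartedSpace (EuclideanSpace ℝ (Fin (n + 1))) M] [IsManifold (𝓡 (n + 1)) ∞ M]

/-- The components of the velocity of a curve are the derivatives of its coordinates. -/
theorem hasDerivAt_extChartAt_comp {σ : ℝ → M} {t : ℝ} (p : M)
    {L : TangentSpace 𝓘(ℝ, ℝ) t →L[ℝ] TangentSpace (𝓡 (n + 1)) (σ t)}
    (hσ : HasMFDerivAt 𝓘(ℝ, ℝ) (𝓡 (n + 1)) σ t L)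
    (ht : σ t ∈ (chartAt (EuclideanSpace ℝ (Fin (n + 1))) p).source) :
    HasDerivAt (fun s ↦ extChartAt (𝓡 (n + 1)) p (σ s))
      (trivializationAt (EuclideanSpace ℝ (Fin (n + 1))) (TangentSpace (𝓡 (n + 1))) p
        (⟨σ t, L (1 : ℝ)⟩ : TangentBundle (𝓡 (n + 1)) M)).2 t := by
  have h1 : MDifferentiableAt (𝓡 (n + 1)) 𝓘(ℝ, EuclideanSpace ℝ (Fin (n + 1)))
    (extChartAt (𝓡 (n + 1)) p) (σ t) := mdifferentiableAt_extChartAt ht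
  have h2 := hasMFDerivAt_iff_hasFDerivAt.1 (h1.hasMFDerivAt.comp t hσ)
  refine HasFDerivAt.congr_fderiv h2 (ContinuousLinearMap.ext_ring ?_)
  have h3 := TangentBundle.continuousLinearMapAt_trivializationAt (I := 𝓡 (n + 1)) ht
  refine Eq.trans ?_ (one_smul ℝ _).symm
  have h4 (v : TangentSpace (𝓡 (n + 1)) (σ t)) :
      (trivializationAt (EuclideanSpace ℝ (Fin (n + 1)))
        (TangentSpace (𝓡 (n + 1))) p).continuousLinearMapAt ℝ (σ t) v =
      (trivializationAt (EuclideanSpace ℝ (Fin (n + 1))) (TangentSpace (𝓡 (n + 1))) p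
        (⟨σ t, v⟩ : TangentBundle (𝓡 (n + 1)) M)).2 := by
    rw [Trivialization.continuousLinearMapAt_apply, Trivialization.linearMapAt_apply]
    exact if_pos (by simpa using ht)
  exact (DFunLike.congr_fun h3 (L (1 : ℝ))).symm.trans (h4 _)

end Spacetime

theorem hasDerivAt_comp_curve {F : Type*} [NormedAddCommGroup F] [NormedSpace ℝ F] {m : ℕ}
    {Q : Type*} [TopologicalSpace Q] [ChartedSpace (EuclideanSpace ℝ (Fin m)) Q]
    {h : Q → F} {σ : ℝ → Q} {t : ℝ} {L : TangentSpace 𝓘(ℝ, ℝ) t →L[ℝ] TangentSpace (𝓡 m) (σ t)}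
    (hh : MDifferentiableAt (𝓡 m) 𝓘(ℝ, F) h (σ t))
    (hσ : HasMFDerivAt 𝓘(ℝ, ℝ) (𝓡 m) σ t L) {v : TangentSpace (𝓡 m) (σ t)}
    (hv : L (1 : ℝ) = v) :
    HasDerivAt (fun s ↦ h (σ s)) (mfderiv (𝓡 m) 𝓘(ℝ, F) h (σ t) v : F) t := by
  subst hv
  have h1 := hasMFDerivAt_iff_hasFDerivAt.1 (hh.hasMFDerivAt.comp t hσ)
  refine HasFDerivAt.congr_fderiv h1 (ContinuousLinearMap.ext_ring ?_)
  exact (one_smul ℝ _).symm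

namespace Spacetime

variable {n : ℕ} {M : Type*} [TopologicalSpace M]
  [ChartedSpace (EuclideanSpace ℝ (Fin (n + 1))) M] [IsManifold (𝓡 (n + 1)) ∞ M]

theorem components_self {Q : Type*} (f : Q → M)
    (X : ∀ x, TangentSpace (𝓡 (n + 1)) (f x)) (x : Q) : components f X x x = X x :=
  trivializationAt_self (f x) (X x)

namespace IsLevelSetNormalOn

variable {S : Spacetime n M} {U : Set M} {τ : M → ℝ} {ν : ∀ p : M, TangentSpace (𝓡 (n + 1)) p}

theorem mfderiv_normal_pos (hν : S.IsLevelSetNormalOn U τ ν)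
    (hinc : ∀ p ∈ U, ∀ v : TangentSpace (𝓡 (n + 1)) p, S.FutureCausal v →
      (0 : ℝ) < mfderiv (𝓡 (n + 1)) 𝓘(ℝ, ℝ) τ p v) {p : M} (hp : p ∈ U) :
    (0 : ℝ) < mfderiv (𝓡 (n + 1)) 𝓘(ℝ, ℝ) τ p (ν p) :=
  hinc p hp (ν p) ⟨(hν.future p hp).1.le, (hν.future p hp).2⟩

theorem mfderiv_eq (hν : S.IsLevelSetNormalOn U τ ν)
    (hinc : ∀ p ∈ U, ∀ v : TangentSpace (𝓡 (n + 1)) p, S.FutureCausal v →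
      (0 : ℝ) < mfderiv (𝓡 (n + 1)) 𝓘(ℝ, ℝ) τ p v) {p : M} (hp : p ∈ U)
    (v : TangentSpace (𝓡 (n + 1)) p) :
    mfderiv (𝓡 (n + 1)) 𝓘(ℝ, ℝ) τ p v =
      @HMul.hMul ℝ ℝ ℝ _ (mfderiv (𝓡 (n + 1)) 𝓘(ℝ, ℝ) τ p (ν p)) (-S.g p (ν p) v) :=
  form_eq_neg_mul_bilin (S.g p) (mfderiv (𝓡 (n + 1)) 𝓘(ℝ, ℝ) τ p) (hν.unit p hp)
    (hν.mfderiv_normal_pos hinc hp) (hν.normal p hp) v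

theorem components_contMDiffAt (hν : S.IsLevelSetNormalOn U τ ν) (hU : IsOpen U) {p : M}
    (hp : p ∈ U) : ContMDiffAt (𝓡 (n + 1)) 𝓘(ℝ, EuclideanSpace ℝ (Fin (n + 1))) ∞
      (components (fun q : M ↦ q) ν p) p :=
  (contMDiffAt_totalSpace.1 (hν.smooth.contMDiffAt (hU.mem_nhds hp))).2

end IsLevelSetNormalOn

section Hypersurface

variable {m : ℕ} {Q : Type*} [TopologicalSpace Q] [ChartedSpace (EuclideanSpace ℝ (Fin m)) Q]
  {S : Spacetime n M} {f : Q → M} {ν : ∀ x, TangentSpace (𝓡 (n + 1)) (f x)}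

theorem IsFutureUnitNormal.contMDiff_map (hν : S.IsFutureUnitNormal (m := m) f ν) :
    ContMDiff (𝓡 m) (𝓡 (n + 1)) ∞ f :=
  fun x ↦ (contMDiffAt_totalSpace.1 (hν.smooth x)).1

theorem IsFutureUnitNormal.components_contMDiffAt (hν : S.IsFutureUnitNormal (m := m) f ν) (x : Q) :
    ContMDiffAt (𝓡 m) 𝓘(ℝ, EuclideanSpace ℝ (Fin (n + 1))) ∞ (components f ν x) x :=
  (contMDiffAt_totalSpace.1 (hν.smooth x)).2

end Hypersurface

theorem metricCoeff_eventuallyEq (S : Spacetime n M) (p : M)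
    (v w : EuclideanSpace ℝ (Fin (n + 1))) :
    S.metricCoeff p v w =ᶠ[𝓝 p] fun q ↦ S.metricInChart p q v w := by
  filter_upwards [(chartAt (EuclideanSpace ℝ (Fin (n + 1))) p).open_source.mem_nhds
    (mem_chart_source _ p)] with q hq
  exact (S.metricInChart_apply p q hq v w).symm

theorem metricCoeff_mdifferentiableAt (S : Spacetime n M) (p : M)
    (v w : EuclideanSpace ℝ (Fin (n + 1))) :
    MDifferentiableAt (𝓡 (n + 1)) 𝓘(ℝ, ℝ) (S.metricCoeff p v w) p := by
  refine ContMDiffAt.mdifferentiableAt (n := ∞) ?_ (by simp)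
  exact (((S.metricInChart_contMDiffAt p).clm_apply contMDiffAt_const).clm_apply
    contMDiffAt_const).congr_of_eventuallyEq (S.metricCoeff_eventuallyEq p v w)

/-- The derivative at `p` of the metric in the preferred chart around `p`. -/
noncomputable def dMetricInChart (S : Spacetime n M) (p : M) :
    EuclideanSpace ℝ (Fin (n + 1)) →L[ℝ] EuclideanSpace ℝ (Fin (n + 1)) →L[ℝ]
      EuclideanSpace ℝ (Fin (n + 1)) →L[ℝ] ℝ :=
  mfderiv (𝓡 (n + 1)) 𝓘(ℝ, EuclideanSpace ℝ (Fin (n + 1)) →L[ℝ]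
    EuclideanSpace ℝ (Fin (n + 1)) →L[ℝ] ℝ) (S.metricInChart p) p

/-- Evaluation at fixed `v`, `w` commutes with differentiation. This makes the Christoffel symbols
visibly linear in each argument and ties them to the product rule. -/
theorem dMetricCoeff_eq (S : Spacetime n M) (p : M) (u v w : EuclideanSpace ℝ (Fin (n + 1))) :
    S.dMetricCoeff p u v w = S.dMetricInChart p u v w := by
  obtain ⟨σ, rfl, -, hσd⟩ := exists_curve p u
  have hσc : Tendsto σ (𝓝 0) (𝓝 (σ 0)) := hσd.continuousAt
  have hLu : ((1 : ℝ →L[ℝ] ℝ).smulRight u) (1 : ℝ) = u := one_smul ℝ u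
  have hG : HasDerivAt (fun t ↦ S.metricInChart (σ 0) (σ t)) (S.dMetricInChart (σ 0) u) 0 :=
    hasDerivAt_comp_curve ((S.metricInChart_contMDiffAt (σ 0)).mdifferentiableAt
      (by simp)) hσd hLu
  have h1 := hasDerivAt_comp_curve (S.metricCoeff_mdifferentiableAt (σ 0) v w) hσd hLu
  have h2 := (hG.clm_apply (hasDerivAt_const (0 : ℝ) v)).clm_apply (hasDerivAt_const (0 : ℝ) w)
  have h3 := h2.congr_of_eventuallyEq (hσc.eventually (S.metricCoeff_eventuallyEq (σ 0) v w))
  exact (h1.unique h3).trans (by simp)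

/-- For a vector field of constant length, `g(∇_v ν, ν) = 0`. -/
theorem IsLevelSetNormalOn.covDeriv_normal {S : Spacetime n M} {U : Set M} {τ : M → ℝ}
    {ν : ∀ p : M, TangentSpace (𝓡 (n + 1)) p} (hν : S.IsLevelSetNormalOn U τ ν) (hU : IsOpen U)
    {p : M} (hp : p ∈ U) (v : TangentSpace (𝓡 (n + 1)) p) :
    S.covDeriv (fun q : M ↦ q) ν p v (ν p) = 0 := by
  obtain ⟨σ, rfl, -, hσd⟩ := exists_curve p v
  have hσc : Tendsto σ (𝓝 0) (𝓝 (σ 0)) := hσd.continuousAt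
  have hLv : ((1 : ℝ →L[ℝ] ℝ).smulRight v) (1 : ℝ) = v := one_smul ℝ v
  obtain ⟨G', hG, hcoef⟩ : ∃ G' : EuclideanSpace ℝ (Fin (n + 1)) →L[ℝ]
      EuclideanSpace ℝ (Fin (n + 1)) →L[ℝ] ℝ,
      HasDerivAt (fun t ↦ S.metricInChart (σ 0) (σ t)) G' 0 ∧
      ∀ a b, S.dMetricCoeff (σ 0) v a b = G' a b :=
    ⟨_, hasDerivAt_comp_curve ((S.metricInChart_contMDiffAt (σ 0)).mdifferentiableAt
      (by simp)) hσd hLv, S.dMetricCoeff_eq (σ 0) v⟩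
  obtain ⟨N', hN, hN'⟩ : ∃ N' : EuclideanSpace ℝ (Fin (n + 1)),
      HasDerivAt (fun t ↦ components (fun q : M ↦ q) ν (σ 0) (σ t)) N' 0 ∧
      mfderiv (𝓡 (n + 1)) 𝓘(ℝ, EuclideanSpace ℝ (Fin (n + 1)))
        (components (fun q : M ↦ q) ν (σ 0)) (σ 0) v = N' :=
    ⟨_, hasDerivAt_comp_curve ((hν.components_contMDiffAt hU hp).mdifferentiableAt
      (by simp)) hσd hLv, rfl⟩
  -- Differentiate `g(ν, ν) = -1` along the curve. In `christoffel`, with second and third vectors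
  -- both `ν`, two terms cancel and half the derivative of the metric remains.
  have hprod := (hG.clm_apply hN).clm_apply hN
  have hconst : HasDerivAt (fun t ↦ S.metricInChart (σ 0) (σ t)
      (components (fun q : M ↦ q) ν (σ 0) (σ t)) (components (fun q : M ↦ q) ν (σ 0) (σ t)))
      0 (0 : ℝ) := by
    refine (hasDerivAt_const (0 : ℝ) (-1 : ℝ)).congr_of_eventuallyEq ?_
    filter_upwards [hσc.eventually (hU.mem_nhds hp), hσc.eventually
      ((chartAt (EuclideanSpace ℝ (Fin (n + 1))) (σ 0)).open_source.mem_nhds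
        (mem_chart_source _ _))] with t ht ht'
    exact (S.metricInChart_apply_components _ _ ht' _ _).trans (hν.unit _ ht)
  have h0 := hprod.unique hconst
  rw [components_self (fun q : M ↦ q) ν (σ 0)] at h0
  have hs (a b : TangentSpace (𝓡 (n + 1)) (σ 0)) := S.metricInChart_self (σ 0) a b
  have hid : mfderiv (𝓡 (n + 1)) (𝓡 (n + 1)) (fun q : M ↦ q) (σ 0) v = v := by
    exact DFunLike.congr_fun mfderiv_id v
  have h1 : S.metricInChart (σ 0) (σ 0) N' (ν (σ 0)) + S.metricInChart (σ 0) (σ 0) (ν (σ 0)) N'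
      + G' (ν (σ 0)) (ν (σ 0)) = 0 := by
    have haux (A B : EuclideanSpace ℝ (Fin (n + 1)) →L[ℝ] EuclideanSpace ℝ (Fin (n + 1)) →L[ℝ] ℝ)
        (x y : EuclideanSpace ℝ (Fin (n + 1))) :
        B y x + B x y + A x x = (A x + B y) x + B x y := by
      rw [add_apply]
      ring
    exact (haux _ _ _ _).trans h0
  have h2 : S.g (σ 0) N' (ν (σ 0)) + S.g (σ 0) (ν (σ 0)) N'
      + S.dMetricCoeff (σ 0) v (ν (σ 0)) (ν (σ 0)) = 0 :=
    (congr (congrArg _ (congr (congrArg _ (hs N' (ν (σ 0)))) (hs (ν (σ 0)) N')))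
      (hcoef _ _).symm).symm.trans h1
  have h3 : S.g (σ 0) (ν (σ 0)) N' = S.g (σ 0) N' (ν (σ 0)) := S.symm (σ 0) (ν (σ 0)) N'
  simp only [covDeriv, christoffel, hid, hN']
  linarith

/-- The components of the velocity field of a smooth curve are continuous. -/
theorem continuousAt_velocity_components {σ : ℝ → M}
    (hσ : ContMDiffAt 𝓘(ℝ, ℝ) (𝓡 (n + 1)) ∞ σ 0) :
    ContinuousAt (fun t ↦ (trivializationAt (EuclideanSpace ℝ (Fin (n + 1)))
      (TangentSpace (𝓡 (n + 1))) (σ 0) (⟨σ t, mfderiv 𝓘(ℝ, ℝ) (𝓡 (n + 1)) σ t (1 : ℝ)⟩ :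
        TangentBundle (𝓡 (n + 1)) M)).2) 0 := by
  have h1 : ContDiffAt ℝ 1 (fun t ↦ extChartAt (𝓡 (n + 1)) (σ 0) (σ t)) 0 := by
    apply ContMDiffAt.contDiffAt
    exact ((contMDiffAt_extChartAt (n := ∞)).comp (0 : ℝ) hσ).of_le (by simp)
  have h2 : ContinuousAt (deriv fun t ↦ extChartAt (𝓡 (n + 1)) (σ 0) (σ t)) 0 :=
    ((h1.fderiv_right (m := 0) (by simp)).continuousAt).clm_apply continuousAt_const
  refine h2.congr ?_
  have h3 : ∀ᶠ t in 𝓝 (0 : ℝ), ContMDiffAt 𝓘(ℝ, ℝ) (𝓡 (n + 1)) 1 σ t :=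
    (contMDiffAt_iff_contMDiffAt_nhds (by simp)).1 (hσ.of_le (by simp))
  filter_upwards [h3, hσ.continuousAt.eventually
      ((chartAt (EuclideanSpace ℝ (Fin (n + 1))) (σ 0)).open_source.mem_nhds
        (mem_chart_source _ _))] with t ht ht'
  exact (hasDerivAt_extChartAt_comp (σ 0) (ht.mdifferentiableAt (by simp)).hasMFDerivAt ht').deriv

/-! ### Comparison of second fundamental forms -/

/-- Where `τ` restricted to a spacelike hypersurface has a local maximum and the unit normals agree,
the second fundamental form of the hypersurface is bounded by that of the level set. -/
theorem covDeriv_le_of_isLocalMax {S : Spacetime n M} {U : Set M} {τ : M → ℝ}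
    {ν : ∀ p : M, TangentSpace (𝓡 (n + 1)) p} (hν : S.IsLevelSetNormalOn U τ ν) (hU : IsOpen U)
    (hτ : ContMDiffOn (𝓡 (n + 1)) 𝓘(ℝ, ℝ) ∞ τ U)
    (hinc : ∀ p ∈ U, ∀ v : TangentSpace (𝓡 (n + 1)) p, S.FutureCausal v →
      (0 : ℝ) < mfderiv (𝓡 (n + 1)) 𝓘(ℝ, ℝ) τ p v)
    {m : ℕ} {Q : Type*} [TopologicalSpace Q] [ChartedSpace (EuclideanSpace ℝ (Fin m)) Q]
    [IsManifold (𝓡 m) ∞ Q] {f : Q → M} {νf : ∀ x, TangentSpace (𝓡 (n + 1)) (f x)}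
    (hf : S.IsFutureUnitNormal (m := m) f νf) {x : Q} (hx : f x ∈ U)
    (hmax : IsLocalMax (fun x ↦ τ (f x)) x) (hN : νf x = ν (f x)) (ξ : TangentSpace (𝓡 m) x) :
    S.covDeriv f νf x ξ (mfderiv (𝓡 m) (𝓡 (n + 1)) f x ξ) ≤
      S.covDeriv (fun q : M ↦ q) ν (f x) (mfderiv (𝓡 m) (𝓡 (n + 1)) f x ξ)
        (mfderiv (𝓡 m) (𝓡 (n + 1)) f x ξ) := by
  by_contra! hlt
  obtain ⟨γ, rfl, hγ, hγd⟩ := exists_curve x ξ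
  have hfs := hf.contMDiff_map
  have hσ : ContMDiffAt 𝓘(ℝ, ℝ) (𝓡 (n + 1)) ∞ (fun t ↦ f (γ t)) 0 := hfs.contMDiffAt.comp 0 hγ
  have hLξ : ((1 : ℝ →L[ℝ] ℝ).smulRight ξ) (1 : ℝ) = ξ := one_smul ℝ ξ
  have hfd := (hfs.mdifferentiable (by simp)) (γ 0)
  have hσd := hfd.hasMFDerivAt.comp (0 : ℝ) hγd
  have hLV : ((mfderiv (𝓡 m) (𝓡 (n + 1)) f (γ 0)).comp ((1 : ℝ →L[ℝ] ℝ).smulRight ξ)) (1 : ℝ) =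
    mfderiv (𝓡 m) (𝓡 (n + 1)) f (γ 0) ξ := congrArg _ hLξ
  set V := mfderiv (𝓡 m) (𝓡 (n + 1)) f (γ 0) ξ with hV
  have hVσ : mfderiv 𝓘(ℝ, ℝ) (𝓡 (n + 1)) (fun t ↦ f (γ t)) 0 (1 : ℝ) = V :=
    (DFunLike.congr_fun hσd.mfderiv (1 : ℝ)).trans hLV
  obtain ⟨A, hA, hA'⟩ : ∃ A : EuclideanSpace ℝ (Fin (n + 1)),
      HasDerivAt (fun t ↦ components f νf (γ 0) (γ t)) A 0 ∧
      mfderiv (𝓡 m) 𝓘(ℝ, EuclideanSpace ℝ (Fin (n + 1))) (components f νf (γ 0)) (γ 0) ξ = A :=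
    ⟨_, hasDerivAt_comp_curve ((hf.components_contMDiffAt (γ 0)).mdifferentiableAt
      (by simp)) hγd hLξ, rfl⟩
  obtain ⟨B, hB, hB'⟩ : ∃ B : EuclideanSpace ℝ (Fin (n + 1)),
      HasDerivAt (fun t ↦ components (fun q : M ↦ q) ν (f (γ 0)) (f (γ t))) B 0 ∧
      mfderiv (𝓡 (n + 1)) 𝓘(ℝ, EuclideanSpace ℝ (Fin (n + 1)))
        (components (fun q : M ↦ q) ν (f (γ 0))) (f (γ 0)) V = B :=
    ⟨_, hasDerivAt_comp_curve (σ := f ∘ γ) ((hν.components_contMDiffAt hU hx).mdifferentiableAt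
      (by simp)) hσd hLV, rfl⟩
  have hid : mfderiv (𝓡 (n + 1)) (𝓡 (n + 1)) (fun q : M ↦ q) (f (γ 0)) V = V :=
    DFunLike.congr_fun mfderiv_id V
  -- Both fields have the same value here and are differentiated along the same `V`, so the
  -- Christoffel terms cancel and the negated inequality becomes `g(A - B, V) > 0`.
  have hpos : 0 < S.metricInChart (f (γ 0)) (f (γ 0)) (A - B) V := by
    have h1 : S.g (f (γ 0)) B V < S.g (f (γ 0)) A V := by
      simp only [covDeriv, hA', hB', hid, hN] at hlt
      exact (add_lt_add_iff_right _).1 hlt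
    have h2 : S.g (f (γ 0)) (A - B) V = S.g (f (γ 0)) A V - S.g (f (γ 0)) B V :=
      DFunLike.congr_fun ((S.g (f (γ 0))).map_sub A B) V
    rw [S.metricInChart_self (f (γ 0)) (A - B) V, h2]
    exact sub_pos.2 h1
  have hm0 : components f νf (γ 0) (γ 0) -
      components (fun q : M ↦ q) ν (f (γ 0)) (f (γ 0)) = 0 := by
    rw [components_self f νf, components_self (fun q : M ↦ q) ν, hN]
    exact sub_self _
  have hG : ContinuousAt (fun t ↦ S.metricInChart (f (γ 0)) (f (γ t))) 0 :=
    ContinuousAt.comp' (S.metricInChart_contMDiffAt (f (γ 0))).continuousAt hσ.continuousAt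
  have hev := eventually_bilin_pos hG (continuousAt_velocity_components hσ) (hA.sub hB) hm0 (by
    rw [hVσ, trivializationAt_self]
    exact hpos)
  have hγev : ∀ᶠ t in 𝓝 (0 : ℝ), ContMDiffAt 𝓘(ℝ, ℝ) (𝓡 m) 1 γ t :=
    (contMDiffAt_iff_contMDiffAt_nhds (by simp)).1 (hγ.of_le (by simp))
  have hUev : ∀ᶠ t in 𝓝 (0 : ℝ), f (γ t) ∈ U := hσ.continuousAt.eventually (hU.mem_nhds hx)
  have hCev : ∀ᶠ t in 𝓝 (0 : ℝ),
      f (γ t) ∈ (chartAt (EuclideanSpace ℝ (Fin (n + 1))) (f (γ 0))).source :=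
    hσ.continuousAt.eventually ((chartAt (EuclideanSpace ℝ (Fin (n + 1)))
      (f (γ 0))).open_source.mem_nhds (mem_chart_source _ _))
  refine not_isLocalMax_of_hasDerivAt_pos (u := fun t ↦ τ (f (γ t)))
    (d := fun t ↦ mfderiv (𝓡 (n + 1)) 𝓘(ℝ, ℝ) τ (f (γ t))
      (mfderiv 𝓘(ℝ, ℝ) (𝓡 (n + 1)) (fun t ↦ f (γ t)) t (1 : ℝ))) ?_ ?_
    (hγ.continuousAt.eventually hmax)
  · filter_upwards [hγev, hUev] with t ht htU
    have h1 : MDifferentiableAt 𝓘(ℝ, ℝ) (𝓡 (n + 1)) (fun t ↦ f (γ t)) t :=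
      ((hfs.mdifferentiable (by simp)) (γ t)).comp t (ht.mdifferentiableAt (by simp))
    exact hasDerivAt_comp_curve ((hτ.contMDiffAt (hU.mem_nhds htU)).mdifferentiableAt (by simp))
      h1.hasMFDerivAt rfl
  · filter_upwards [hev, nhdsWithin_le_nhds hγev, nhdsWithin_le_nhds hUev,
      nhdsWithin_le_nhds hCev] with t ht htγ htU htC
    -- The derivative of `τ` is `dτ(ν) · (-g(ν, σ'))`. As `g(νf, σ') = 0`, the second factor equals
    -- `g(νf - ν, σ')`, positive for small `t > 0` by `hev`.
    have h1 := hν.mfderiv_eq hinc htU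
      (mfderiv 𝓘(ℝ, ℝ) (𝓡 (n + 1)) (fun t ↦ f (γ t)) t (1 : ℝ))
    rw [h1]
    refine mul_pos (hν.mfderiv_normal_pos hinc htU) ?_
    have h2 : mfderiv 𝓘(ℝ, ℝ) (𝓡 (n + 1)) (fun t ↦ f (γ t)) t (1 : ℝ) =
        mfderiv (𝓡 m) (𝓡 (n + 1)) f (γ t) (mfderiv 𝓘(ℝ, ℝ) (𝓡 m) γ t (1 : ℝ)) :=
      DFunLike.congr_fun (mfderiv_comp t ((hfs.mdifferentiable (by simp)) (γ t))
        (htγ.mdifferentiableAt (by simp))) (1 : ℝ)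
    have h3 : S.g (f (γ t)) (νf (γ t))
        (mfderiv 𝓘(ℝ, ℝ) (𝓡 (n + 1)) (fun t ↦ f (γ t)) t (1 : ℝ)) = 0 := by
      rw [h2]
      exact hf.normal (γ t) _
    rw [← S.metricInChart_apply_components _ _ htC] at h3 ⊢
    simp only [Pi.sub_apply, map_sub, sub_apply] at ht
    rw [show S.metricInChart (f (γ 0)) (f (γ t)) (components f νf (γ 0) (γ t)) _ = 0 from h3,
      zero_sub] at ht
    exact ht

end Spacetime

end NoCrushing

namespace NoCrushing

/-! ### Traces in orthonormal frames -/

open Matrix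

section Trace

variable {N : ℕ}

theorem bilin_eq_sum (K : EuclideanSpace ℝ (Fin N) →ₗ[ℝ] EuclideanSpace ℝ (Fin N) →ₗ[ℝ] ℝ)
    (v w : EuclideanSpace ℝ (Fin N)) :
    K v w = ∑ i, ∑ j, v i * w j *
      K (EuclideanSpace.single i (1 : ℝ)) (EuclideanSpace.single j (1 : ℝ)) := by
  have hexp (u : EuclideanSpace ℝ (Fin N)) : u = ∑ i, u i • EuclideanSpace.single i (1 : ℝ) := by
    ext k
    simp [Finset.sum_apply, Pi.single_apply]
  conv_lhs => rw [hexp v, hexp w]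
  simp only [map_sum, map_smul, LinearMap.sum_apply, LinearMap.smul_apply, smul_eq_mul,
    Finset.mul_sum, mul_assoc]
  rw [Finset.sum_comm]
  exact Finset.sum_congr rfl fun _ _ ↦ Finset.sum_congr rfl fun _ _ ↦ by ring

/-- The trace of a bilinear form with respect to a scalar product, computed in an orthonormal
frame. -/
theorem sum_inv_gram_mul (g K : EuclideanSpace ℝ (Fin N) →ₗ[ℝ] EuclideanSpace ℝ (Fin N) →ₗ[ℝ] ℝ)
    (b : Fin N → EuclideanSpace ℝ (Fin N)) (d : Fin N → ℝ) (hd : ∀ k, d k * d k = 1)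
    (hb : ∀ k l, g (b k) (b l) = if k = l then d k else 0) :
    ∑ i, ∑ j, (Matrix.of fun i j : Fin N ↦
        g (EuclideanSpace.single i (1 : ℝ)) (EuclideanSpace.single j (1 : ℝ)))⁻¹ i j *
      K (EuclideanSpace.single i (1 : ℝ)) (EuclideanSpace.single j (1 : ℝ)) =
      ∑ k, d k * K (b k) (b k) := by
  set G : Matrix (Fin N) (Fin N) ℝ := Matrix.of fun i j : Fin N ↦
        g (EuclideanSpace.single i (1 : ℝ)) (EuclideanSpace.single j (1 : ℝ)) with hG
  set P : Matrix (Fin N) (Fin N) ℝ := Matrix.of fun i k ↦ b k i with hP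
  have h1 : Pᵀ * G * P = diagonal d := by
    ext k l
    rw [diagonal_apply, ← hb k l, bilin_eq_sum, Finset.sum_comm]
    simp only [mul_apply, Finset.sum_mul, hP, hG, of_apply, transpose_apply]
    exact Finset.sum_congr rfl fun _ _ ↦ Finset.sum_congr rfl fun _ _ ↦ by ring
  have hdd : diagonal d * diagonal d = (1 : Matrix (Fin N) (Fin N) ℝ) := by
    rw [diagonal_mul_diagonal, ← diagonal_one]
    exact congrArg diagonal (funext hd)
  -- A one-sided inverse of a square matrix is two-sided, so `P` may be moved to the front, giving
  -- `G⁻¹ = P D Pᵀ` with `D = diagonal d`. Entries `±1` of `d` cover both signatures.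
  have h2 : (diagonal d * Pᵀ * G) * P = 1 := by
    rw [Matrix.mul_assoc (diagonal d), Matrix.mul_assoc, h1, hdd]
  have h3 : P * diagonal d * Pᵀ * G = 1 := by
    rw [← mul_eq_one_comm.1 h2]
    simp only [Matrix.mul_assoc]
  rw [Matrix.inv_eq_left_inv h3]
  have h4 (i j : Fin N) : (P * diagonal d * Pᵀ) i j = ∑ k, b k i * d k * b k j := by
    rw [mul_apply]
    simp [hP]
  simp only [h4, bilin_eq_sum K (b _) (b _), Finset.mul_sum, Finset.sum_mul]
  conv_rhs => rw [Finset.sum_comm]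
  refine Finset.sum_congr rfl fun _ _ ↦ ?_
  conv_rhs => rw [Finset.sum_comm]
  exact Finset.sum_congr rfl fun _ _ ↦ Finset.sum_congr rfl fun _ _ ↦ by ring

/-- A positive definite symmetric bilinear form has an orthonormal frame. -/
theorem exists_orthonormal_frame
    (g : EuclideanSpace ℝ (Fin N) →ₗ[ℝ] EuclideanSpace ℝ (Fin N) →ₗ[ℝ] ℝ)
    (hsymm : ∀ v w, g v w = g w v) (hpos : ∀ v, v ≠ 0 → 0 < g v v) :
    ∃ b : Fin N → EuclideanSpace ℝ (Fin N), ∀ k l, g (b k) (b l) = if k = l then 1 else 0 := by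
  set G : Matrix (Fin N) (Fin N) ℝ := Matrix.of fun i j : Fin N ↦
        g (EuclideanSpace.single i (1 : ℝ)) (EuclideanSpace.single j (1 : ℝ)) with hG
  have hval (v : Fin N → ℝ) : v ⬝ᵥ (G *ᵥ v) = g (WithLp.toLp 2 v) (WithLp.toLp 2 v) := by
    rw [bilin_eq_sum]
    simp only [dotProduct, mulVec, hG, of_apply, Finset.mul_sum]
    exact Finset.sum_congr rfl fun _ _ ↦ Finset.sum_congr rfl fun _ _ ↦ by ring
  have hpd : G.PosDef := by
    refine PosDef.of_dotProduct_mulVec_pos ?_ fun v hv ↦ ?_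
    · ext i j
      simp [hG, hsymm]
    · rw [star_trivial, hval]
      exact hpos _ (by simpa using hv)
  open scoped MatrixOrder in
  -- Factor `G = Xᵀ X`; the columns of `X⁻¹` are then orthonormal for `g`.
  obtain ⟨X, hX⟩ := CStarAlgebra.nonneg_iff_eq_star_mul_self.mp hpd.posSemidef.nonneg
  rw [star_eq_conjTranspose, conjTranspose_eq_transpose_of_trivial] at hX
  have hdet : IsUnit X.det := by
    have h := hpd.det_pos
    rw [hX, det_mul] at h
    exact isUnit_iff_ne_zero.2 (right_ne_zero_of_mul h.ne')
  have h1 : X⁻¹ᵀ * G * X⁻¹ = 1 := by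
    rw [hX, Matrix.mul_assoc, Matrix.mul_assoc, mul_nonsing_inv _ hdet, Matrix.mul_one,
      ← transpose_mul, mul_nonsing_inv _ hdet, transpose_one]
  refine ⟨fun k ↦ WithLp.toLp 2 fun i ↦ X⁻¹ i k, fun k l ↦ ?_⟩
  rw [bilin_eq_sum, ← one_apply, ← h1, Finset.sum_comm]
  simp only [mul_apply, Finset.sum_mul, hG, of_apply, transpose_apply]
  exact Finset.sum_congr rfl fun _ _ ↦ Finset.sum_congr rfl fun _ _ ↦ by ring

end Trace

end NoCrushing

namespace NoCrushing

namespace Spacetime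

variable {n : ℕ} {M : Type*} [TopologicalSpace M]
  [ChartedSpace (EuclideanSpace ℝ (Fin (n + 1))) M] [IsManifold (𝓡 (n + 1)) ∞ M]

theorem christoffel_eq (S : Spacetime n M) (p : M) (u v w : EuclideanSpace ℝ (Fin (n + 1))) :
    S.christoffel p u v w = (S.dMetricInChart p u v w + S.dMetricInChart p v u w
      - S.dMetricInChart p w u v) / 2 := by
  simp only [christoffel, dMetricCoeff_eq]

/-! ### Divergence as a frame-independent trace -/

section Divergence

variable {m : ℕ} {Q : Type*} [TopologicalSpace Q] [ChartedSpace (EuclideanSpace ℝ (Fin m)) Q]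

/-- The metric induced by `f`, as a bilinear form on the model space. -/
noncomputable def pullbackForm (S : Spacetime n M) (f : Q → M) (x : Q) :
    EuclideanSpace ℝ (Fin m) →ₗ[ℝ] EuclideanSpace ℝ (Fin m) →ₗ[ℝ] ℝ :=
  let F : EuclideanSpace ℝ (Fin m) →L[ℝ] EuclideanSpace ℝ (Fin (n + 1)) :=
    mfderiv (𝓡 m) (𝓡 (n + 1)) f x
  let g : EuclideanSpace ℝ (Fin (n + 1)) →L[ℝ] EuclideanSpace ℝ (Fin (n + 1)) →L[ℝ] ℝ :=
    S.g (f x)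
  LinearMap.mk₂ ℝ (fun ξ η ↦ g (F ξ) (F η)) (by simp) (by simp) (by simp) (by simp)

/-- The bilinear form `g(∇_ξ X, df η)` on the model space. -/
noncomputable def covDerivForm (S : Spacetime n M) (f : Q → M)
    (X : ∀ x, TangentSpace (𝓡 (n + 1)) (f x)) (x : Q) :
    EuclideanSpace ℝ (Fin m) →ₗ[ℝ] EuclideanSpace ℝ (Fin m) →ₗ[ℝ] ℝ :=
  let F : EuclideanSpace ℝ (Fin m) →L[ℝ] EuclideanSpace ℝ (Fin (n + 1)) :=
    mfderiv (𝓡 m) (𝓡 (n + 1)) f x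
  let A : EuclideanSpace ℝ (Fin m) →L[ℝ] EuclideanSpace ℝ (Fin (n + 1)) :=
    mfderiv (𝓡 m) 𝓘(ℝ, EuclideanSpace ℝ (Fin (n + 1))) (components f X x) x
  let g : EuclideanSpace ℝ (Fin (n + 1)) →L[ℝ] EuclideanSpace ℝ (Fin (n + 1)) →L[ℝ] ℝ :=
    S.g (f x)
  let D := S.dMetricInChart (f x)
  let Y : EuclideanSpace ℝ (Fin (n + 1)) := X x
  LinearMap.mk₂ ℝ (fun ξ η ↦ g (A ξ) (F η)
      + (D (F ξ) Y (F η) + D Y (F ξ) (F η) - D (F η) (F ξ) Y) / 2)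
    (fun _ _ _ ↦ by simp only [map_add, add_apply]; ring)
    (fun _ _ _ ↦ by simp only [map_smul, smul_apply, smul_eq_mul]; ring)
    (fun _ _ _ ↦ by simp only [map_add, add_apply]; ring)
    (fun _ _ _ ↦ by simp only [map_smul, smul_apply, smul_eq_mul]; ring)

theorem covDerivForm_apply (S : Spacetime n M) (f : Q → M)
    (X : ∀ x, TangentSpace (𝓡 (n + 1)) (f x)) (x : Q) (ξ η : EuclideanSpace ℝ (Fin m)) :
    S.covDerivForm f X x ξ η = S.covDeriv f X x ξ (mfderiv (𝓡 m) (𝓡 (n + 1)) f x η) :=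
  (congrArg (S.g (f x) (mfderiv (𝓡 m) 𝓘(ℝ, EuclideanSpace ℝ (Fin (n + 1)))
    (components f X x) x ξ) (mfderiv (𝓡 m) (𝓡 (n + 1)) f x η) + ·)
    (S.christoffel_eq (f x) _ _ _)).symm

/-- The divergence along `f`, computed in an orthonormal frame. -/
theorem divAlong_eq_sum (S : Spacetime n M) (f : Q → M)
    (X : ∀ x, TangentSpace (𝓡 (n + 1)) (f x)) (x : Q) (b : Fin m → EuclideanSpace ℝ (Fin m))
    (d : Fin m → ℝ) (hd : ∀ k, d k * d k = 1)
    (hb : ∀ k l, S.pullbackForm f x (b k) (b l) = if k = l then d k else 0) :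
    S.divAlong (m := m) f X x =
      ∑ k, d k * S.covDeriv f X x (b k) (mfderiv (𝓡 m) (𝓡 (n + 1)) f x (b k)) := by
  simp only [← covDerivForm_apply]
  rw [← sum_inv_gram_mul _ (S.covDerivForm f X x) b d hd hb]
  simp only [covDerivForm_apply]
  rfl

end Divergence

/-! ### Comparison of mean curvatures at a maximum -/

section Comparison

variable {S : Spacetime n M} {U : Set M} {τ : M → ℝ} {ν : ∀ p : M, TangentSpace (𝓡 (n + 1)) p}
  {Q : Type*} [TopologicalSpace Q] [ChartedSpace (EuclideanSpace ℝ (Fin n)) Q]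
  {f : Q → M} {νf : ∀ x, TangentSpace (𝓡 (n + 1)) (f x)} {x : Q}

omit [IsManifold (𝓡 (n + 1)) ∞ M] in
theorem mfderiv_eq_zero_of_isLocalMax [IsManifold (𝓡 n) ∞ Q]
    (hτ : MDifferentiableAt (𝓡 (n + 1)) 𝓘(ℝ, ℝ) τ (f x))
    (hf : MDifferentiableAt (𝓡 n) (𝓡 (n + 1)) f x) (hmax : IsLocalMax (fun x ↦ τ (f x)) x)
    (ξ : TangentSpace (𝓡 n) x) :
    mfderiv (𝓡 (n + 1)) 𝓘(ℝ, ℝ) τ (f x) (mfderiv (𝓡 n) (𝓡 (n + 1)) f x ξ) = (0 : ℝ) := by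
  obtain ⟨γ, rfl, -, hγd⟩ := exists_curve x ξ
  have hLV : ((mfderiv (𝓡 n) (𝓡 (n + 1)) f (γ 0)).comp ((1 : ℝ →L[ℝ] ℝ).smulRight ξ)) (1 : ℝ) =
    mfderiv (𝓡 n) (𝓡 (n + 1)) f (γ 0) ξ := congrArg _ (one_smul ℝ ξ)
  have h := hasDerivAt_comp_curve (σ := f ∘ γ) hτ (hf.hasMFDerivAt.comp (0 : ℝ) hγd) hLV
  exact IsLocalMax.hasDerivAt_eq_zero (hγd.continuousAt.eventually hmax) h

/-- At a critical point of `τ ∘ f` the unit normals of `f` and of the level set agree. -/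
theorem normal_eq_of_critical (hν : S.IsLevelSetNormalOn U τ ν)
    (hf : S.IsFutureUnitNormal (m := n) f νf) (hsp : S.IsSpacelike (m := n) f) (hx : f x ∈ U)
    (hcrit : ∀ ξ : TangentSpace (𝓡 n) x,
      mfderiv (𝓡 (n + 1)) 𝓘(ℝ, ℝ) τ (f x) (mfderiv (𝓡 n) (𝓡 (n + 1)) f x ξ) = (0 : ℝ)) :
    νf x = ν (f x) := by
  let F : EuclideanSpace ℝ (Fin n) →L[ℝ] EuclideanSpace ℝ (Fin (n + 1)) :=
    mfderiv (𝓡 n) (𝓡 (n + 1)) f x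
  let g : EuclideanSpace ℝ (Fin (n + 1)) →L[ℝ] EuclideanSpace ℝ (Fin (n + 1)) →L[ℝ] ℝ :=
    S.g (f x)
  have hF (ξ : EuclideanSpace ℝ (Fin n)) (hξ : ξ ≠ 0) : 0 < g (F ξ) (F ξ) := hsp x ξ hξ
  have hinj : Function.Injective F := by
    rw [injective_iff_map_eq_zero]
    intro ξ hξ
    by_contra hne
    have h := hF ξ hne
    simp [hξ] at h
  refine unit_normal_unique (V := EuclideanSpace ℝ (Fin (n + 1))) g
    (LinearMap.range (F : EuclideanSpace ℝ (Fin n) →ₗ[ℝ] EuclideanSpace ℝ (Fin (n + 1))))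
    ?_ ?_ (hν.unit _ hx) (hf.unit x) ?_ ?_ (hν.future _ hx).2 (hf.future x).2
  · rw [LinearMap.finrank_range_of_inj hinj]
    simp
  · rintro _ ⟨ξ, rfl⟩ hne
    exact hF ξ fun h ↦ hne (by simp [h])
  · rintro _ ⟨ξ, rfl⟩
    exact hν.normal _ hx _ (hcrit ξ)
  · rintro _ ⟨ξ, rfl⟩
    exact hf.normal x ξ

/-- At a maximum of `τ` on a spacelike hypersurface, the mean curvature of the hypersurface is at
most that of the level set of `τ`. -/
theorem meanCurvature_le_of_isLocalMax [IsManifold (𝓡 n) ∞ Q]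
    (hν : S.IsLevelSetNormalOn U τ ν) (hU : IsOpen U)
    (hτ : ContMDiffOn (𝓡 (n + 1)) 𝓘(ℝ, ℝ) ∞ τ U)
    (hinc : ∀ p ∈ U, ∀ v : TangentSpace (𝓡 (n + 1)) p, S.FutureCausal v →
      (0 : ℝ) < mfderiv (𝓡 (n + 1)) 𝓘(ℝ, ℝ) τ p v)
    (hf : S.IsFutureUnitNormal (m := n) f νf) (hsp : S.IsSpacelike (m := n) f) (hx : f x ∈ U)
    (hmax : IsLocalMax (fun x ↦ τ (f x)) x) :
    S.meanCurvature f νf x ≤ S.levelSetMeanCurvature ν (f x) := by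
  have hcrit := mfderiv_eq_zero_of_isLocalMax
    ((hτ.contMDiffAt (hU.mem_nhds hx)).mdifferentiableAt (by simp))
    (hf.contMDiff_map.mdifferentiable (by simp) x) hmax
  have hN := normal_eq_of_critical hν hf hsp hx hcrit
  obtain ⟨b, hb⟩ := exists_orthonormal_frame (S.pullbackForm (m := n) f x)
    (fun v w ↦ S.symm (f x) _ _) (fun v hv ↦ hsp x v hv)
  have hid (v : TangentSpace (𝓡 (n + 1)) (f x)) :
      mfderiv (𝓡 (n + 1)) (𝓡 (n + 1)) (fun q : M ↦ q) (f x) v = v :=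
    DFunLike.congr_fun mfderiv_id v
  have hform (v w : TangentSpace (𝓡 (n + 1)) (f x)) :
      S.pullbackForm (m := n + 1) (fun q : M ↦ q) (f x) v w = S.g (f x) v w :=
    (congrArg (fun v' ↦ S.g (f x) v'
      (mfderiv (𝓡 (n + 1)) (𝓡 (n + 1)) (fun q : M ↦ q) (f x) w)) (hid v)).trans
      (congrArg (S.g (f x) v) (hid w))
  -- Adding the common normal to a frame of the surface gives a Lorentzian frame, with sign `-1` in
  -- the normal slot. The level set's mean curvature is a trace over the whole tangent space, and
  -- its normal term vanishes because `ν` has constant length.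
  let b' : Fin (n + 1) → EuclideanSpace ℝ (Fin (n + 1)) :=
    Fin.cons (ν (f x)) fun k ↦ mfderiv (𝓡 n) (𝓡 (n + 1)) f x (b k)
  let d : Fin (n + 1) → ℝ := Fin.cons (-1) fun _ ↦ 1
  have hnormal (k : Fin n) :
      S.g (f x) (ν (f x)) (mfderiv (𝓡 n) (𝓡 (n + 1)) f x (b k)) = 0 :=
    hν.normal _ hx _ (hcrit (b k))
  have hb' (k l : Fin (n + 1)) : S.pullbackForm (m := n + 1) (fun q : M ↦ q) (f x) (b' k) (b' l) =
      if k = l then d k else 0 := by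
    refine (hform (b' k) (b' l)).trans ?_
    refine Fin.cases ?_ (fun k ↦ ?_) k <;> refine Fin.cases ?_ (fun l ↦ ?_) l
    · exact (hν.unit _ hx).trans (by simp [d])
    · exact (hnormal l).trans (by simp [Fin.ext_iff])
    · exact ((S.symm (f x) _ _).trans (hnormal k)).trans (by simp)
    · exact (hb k l).trans (by simp [d])
  have h1 := S.divAlong_eq_sum f νf x b (fun _ ↦ 1) (by simp) hb
  have h2 := S.divAlong_eq_sum (m := n + 1) (fun q : M ↦ q) ν (f x) b' d
    (fun k ↦ by refine Fin.cases ?_ (fun k ↦ ?_) k <;> simp [d]) hb'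
  unfold meanCurvature levelSetMeanCurvature
  rw [h1, h2, Fin.sum_univ_succ]
  have h3 : S.covDeriv (m := n + 1) (fun q : M ↦ q) ν (f x) (b' 0)
      (mfderiv (𝓡 (n + 1)) (𝓡 (n + 1)) (fun q : M ↦ q) (f x) (b' 0)) = 0 :=
    (congrArg _ (hid (b' 0))).trans (hν.covDeriv_normal hU hx _)
  rw [h3, mul_zero, zero_add]
  refine Finset.sum_le_sum fun k _ ↦ ?_
  have h4 : d k.succ = 1 := rfl
  rw [h4, one_mul, one_mul]
  refine (covDeriv_le_of_isLocalMax hν hU hτ hinc hf hx hmax hN (b k)).trans_eq ?_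
  exact (congrArg (S.covDeriv (m := n + 1) (fun q : M ↦ q) ν (f x) (b' k.succ))
    (hid (b' k.succ))).symm

end Comparison

end Spacetime

/-! ### First touching time and conclusion -/

/-- A compact family which starts strictly below the level `c` and does not stay there reaches `c`
at a first time. -/
theorem exists_first_touching {Q : Type*} [TopologicalSpace Q] [CompactSpace Q] {F : ℝ → Q → ℝ}
    {s₁ c : ℝ} (hF : ContinuousOn (fun z : ℝ × Q ↦ F z.1 z.2) (Icc 0 s₁ ×ˢ univ))
    (h0 : ∀ x, F 0 x < c) {x₁ : Q} (hs₁ : 0 ≤ s₁) (hx₁ : c ≤ F s₁ x₁) :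
    ∃ s ∈ Ioc 0 s₁, ∃ x, F s x = c ∧ (∀ x', F s x' ≤ c) ∧ ∀ r ∈ Ico 0 s, F r x < c := by
  have hK : IsCompact ((Icc 0 s₁ ×ˢ (univ : Set Q)) ∩ (fun z : ℝ × Q ↦ F z.1 z.2) ⁻¹' Ici c) :=
    (isCompact_Icc.prod isCompact_univ).of_isClosed_subset
      (hF.preimage_isClosed_of_isClosed (isClosed_Icc.prod isClosed_univ) isClosed_Ici)
      inter_subset_left
  obtain ⟨s, ⟨⟨s', x⟩, ⟨⟨hs, -⟩, hx⟩, rfl⟩, hmin⟩ :=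
    (hK.image continuous_fst).exists_isLeast ⟨s₁, (s₁, x₁), ⟨⟨⟨hs₁, le_rfl⟩, mem_univ _⟩, hx₁⟩, rfl⟩
  dsimp only at hmin hs
  have hx : c ≤ F s' x := hx
  have hbefore : ∀ r ∈ Ico 0 s', ∀ x', F r x' < c := fun r hr x' ↦ by
    by_contra! hge
    exact absurd (hmin ⟨(r, x'), ⟨⟨⟨hr.1, hr.2.le.trans hs.2⟩, mem_univ _⟩, hge⟩, rfl⟩)
      (not_le.2 hr.2)
  have hpos : 0 < s' := hs.1.lt_of_ne fun h ↦ by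
    rw [← h] at hx
    exact absurd (h0 x) (not_lt.2 hx)
  -- Let `r` increase to `s'` in the strict bound at earlier times.
  have hle (x' : Q) : F s' x' ≤ c := by
    have h1 : ContinuousWithinAt (fun r ↦ F r x') (Ico 0 s') s' := by
      have h2 := (hF (s', x') ⟨hs, mem_univ _⟩).comp (f := fun r : ℝ ↦ (r, x')) (s := Ico 0 s')
        (x := s') (by fun_prop) fun r hr ↦ ⟨⟨hr.1, hr.2.le.trans hs.2⟩, mem_univ _⟩
      exact h2
    have h3 : Tendsto (fun r ↦ F r x') (𝓝[<] s') (𝓝 (F s' x')) := by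
      rw [← nhdsWithin_Ico_eq_nhdsLT hpos]
      exact h1
    refine le_of_tendsto h3 ?_
    filter_upwards [Ico_mem_nhdsLT hpos] with r hr
    exact (hbefore r hr x').le
  exact ⟨s', ⟨hpos, hs.2⟩, x, le_antisymm (hle x) hx, hle, fun r hr ↦ hbefore r hr x⟩

/-- Only difference quotients from the left are used, since `s` may be the right endpoint of `J`. -/
theorem deriv_nonneg_of_le_left {u : ℝ → ℝ} {u' s : ℝ} {J : Set ℝ} (hs : 0 < s)
    (hJ : Icc 0 s ⊆ J) (hu : HasDerivWithinAt u u' J s) (hle : ∀ r ∈ Ico 0 s, u r ≤ u s) :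
    0 ≤ u' := by
  have h1 := hasDerivWithinAt_iff_tendsto_slope.1 (hu.mono (Ico_subset_Icc_self.trans hJ))
  rw [sdiff_singleton_eq_self (by simp), nhdsWithin_Ico_eq_nhdsLT hs] at h1
  refine ge_of_tendsto h1 ?_
  filter_upwards [Ico_mem_nhdsLT hs] with r hr
  rw [slope_def_field]
  exact div_nonneg_of_nonpos (sub_nonpos.2 (hle r hr)) (sub_nonpos.2 hr.2.le)

end NoCrushing

theorem theorem5 {n : ℕ}
    {M : Type*} [TopologicalSpace M] [T2Space M] [SecondCountableTopology M]
    [ChartedSpace (EuclideanSpace ℝ (Fin (n + 1))) M] [IsManifold (𝓡 (n + 1)) ∞ M]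
    {Q : Type*} [TopologicalSpace Q] [T2Space Q] [CompactSpace Q]
    [ChartedSpace (EuclideanSpace ℝ (Fin n)) Q] [IsManifold (𝓡 n) ∞ Q]
    (S : NoCrushing.Spacetime n M)
    (N : Set M) (τ : M → ℝ) (c₀ : ℝ) (hτ : S.IsFutureCrushing N τ c₀)
    (J : Set ℝ) (hJ : J.OrdConnected) (hJ_nonneg : ∀ s ∈ J, 0 ≤ s) (hJ_zero : (0 : ℝ) ∈ J)
    (y : ℝ → Q → M) (ν : ∀ s x, TangentSpace (𝓡 (n + 1)) (y s x))
    (hflow : S.IsMeanCurvatureFlow J y ν)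
    (hK : ∀ x, 0 ≤ S.meanCurvature (y 0) (ν 0) x) :
    (∀ c, c₀ < c → (∀ x, τ (y 0 x) < c) → ∀ s ∈ J, ∀ x, τ (y s x) < c) ∧
      ∃ c, c₀ < c ∧ ∀ s ∈ J, ∀ x, τ (y s x) < c := by
  have hU : IsOpen (N ∩ {p | c₀ < τ p}) :=
    hτ.isOpen.inter (isOpen_lt continuous_const hτ.continuous)
  obtain ⟨ν', hν', hlt⟩ := hτ.meanCurvature_lt
  have hmain : ∀ c, c₀ < c → (∀ x, τ (y 0 x) < c) → ∀ s ∈ J, ∀ x, τ (y s x) < c := by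
    intro c hc h0 s₁ hs₁ x₁
    by_contra! hge
    have hJs : Icc 0 s₁ ⊆ J := hJ.out hJ_zero hs₁
    obtain ⟨s, hs, x, hx, hmax, hbefore⟩ := NoCrushing.exists_first_touching
      (F := fun s x ↦ τ (y s x)) (c := c)
      (hτ.continuous.comp_continuousOn (hflow.smooth.continuousOn.mono (prod_mono_left hJs)))
      h0 (hJ_nonneg s₁ hs₁) hge
    have hsJ : s ∈ J := hJs ⟨hs.1.le, hs.2⟩
    have hxU : y s x ∈ N ∩ {p | c₀ < τ p} :=
      ⟨hτ.level_subset c hc hx, hc.trans_eq hx.symm⟩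
    have hlocal : IsLocalMax (fun x ↦ τ (y s x)) x :=
      Eventually.of_forall fun x' ↦ (hmax x').trans_eq hx.symm
    have hτs := hτ.cauchyTime.smooth
    have hinc := hτ.cauchyTime.increasing
    have hcmp := NoCrushing.Spacetime.meanCurvature_le_of_isLocalMax hν' hU hτs hinc
      (hflow.normal s hsJ) (hflow.spacelike s hsJ) hxU hlocal
    -- Here `c₀ ≥ 0` enters: the bound `-c` is negative.
    have hneg : S.meanCurvature (y s) (ν s) x < 0 := by
      have h1 := hlt c hc (y s x) hx
      linarith [hτ.nonneg]
    obtain ⟨α, hα⟩ : ∃ α : ℝ, mfderiv (𝓡 (n + 1)) 𝓘(ℝ, ℝ) τ (y s x) (ν s x) = α := ⟨_, rfl⟩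
    have hnormal : 0 < α := hα ▸
      hinc _ hxU _ ⟨((hflow.normal s hsJ).future x).1.le, ((hflow.normal s hsJ).future x).2⟩
    have hderiv := ((hτs.contMDiffAt (hU.mem_nhds hxU)).mdifferentiableAt
      (by simp)).hasMFDerivAt.comp_hasMFDerivWithinAt s (hflow.flow s hsJ x)
    have hd : HasDerivWithinAt (fun r ↦ τ (y r x))
        (S.meanCurvature (y s) (ν s) x * α) J s := by
      refine HasFDerivWithinAt.congr_fderiv (hasMFDerivWithinAt_iff_hasFDerivWithinAt.1 hderiv)
        (ContinuousLinearMap.ext_ring ?_)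
      refine Eq.trans ?_ (one_smul ℝ (S.meanCurvature (y s) (ν s) x * α)).symm
      refine (congrArg (mfderiv (𝓡 (n + 1)) 𝓘(ℝ, ℝ) τ (y s x)) (one_smul ℝ _)).trans ?_
      refine ((mfderiv (𝓡 (n + 1)) 𝓘(ℝ, ℝ) τ (y s x)).map_smul _ _).trans ?_
      exact congrArg (S.meanCurvature (y s) (ν s) x * ·) hα
    have hnonneg := NoCrushing.deriv_nonneg_of_le_left hs.1
      ((Icc_subset_Icc_right hs.2).trans hJs) hd fun r hr ↦ ((hbefore r hr).trans_eq hx.symm).le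
    exact absurd hnonneg (not_le.2 (mul_neg_of_neg_of_pos hneg hnormal))
  refine ⟨hmain, ?_⟩
  have hcont : Continuous fun x ↦ τ (y 0 x) :=
    hτ.continuous.comp (hflow.normal 0 hJ_zero).contMDiff_map.continuous
  obtain ⟨C, hC⟩ := (isCompact_range hcont).bddAbove
  -- Any level above both `c₀` and the bound `C` of `τ` on the compact initial surface works.
  refine ⟨max C c₀ + 1, (le_max_right C c₀).trans_lt (lt_add_one _), hmain _
    ((le_max_right C c₀).trans_lt (lt_add_one _)) fun x ↦ ?_⟩
  exact ((hC (mem_range_self x)).trans (le_max_left C c₀)).trans_lt (lt_add_one _)
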